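/- All rings are associative with identity. Let $R$ be a ring. A \emph{right coprime pair} in a ring $T$ is a pair $(a,b)\in T^2$ with $aT+bT=T$; two such pairs $(a,b)$ and $(a',b')$ are identified when $aT=a'T$ and $bT=b'T$, and the class of $(a,b)$ is denoted by $\langle a,b\rangle$. These classes are partially ordered by $\langle a,b\rangle\le\langle a',b'\rangle$ if and only if $aT\subseteq a'T$ and $bT\subseteq b'T$. A \emph{compatible descending chain} of right coprime pairs is a family $\{p_\alpha\mid\alpha<\kappa\}$ of right coprime pairs, indexed by the ordinals smaller than some ordinal $\kappa$, with $p_\beta\le p_\alpha$ whenever $\alpha\le\beta<\kappa$, such that there are generators $p_\alpha=\langle a_\alpha,b_\alpha\rangle$ and elements $r_{\alpha\beta},s_{\alpha\beta}\in T$ ($\alpha<\beta<\kappa$) with \[a_\beta=a_\alpha r_{\alpha\beta},\quad b_\beta=b_\alpha s_{\alpha\beta}\quad(\alpha<\beta<\kappa),\qquad r_{\alpha\beta}=r_{\alpha\gamma}r_{\gamma\beta},\quad s_{\alpha\beta}=s_{\alpha\gamma}s_{\gamma\beta}\quad(\alpha<\gamma<\beta<\kappa).\] The ring $T$ is \emph{right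 strongly exchange} if every compatible descending chain of right coprime pairs in $T$ has a lower bound which is a minimal element of the partially ordered set of all right coprime pairs of $T$. A left $R$-module $M$ is \emph{continuous} if (C1) every submodule of $M$ is essential in a direct summand of $M$, and (C2) every submodule of $M$ which is isomorphic to a direct summand of $M$ is itself a direct summand of $M$. The ring $R$ is \emph{left continuous} if it is continuous as a left module over itself. \textbf{Theorem.} If $M$ is a continuous left $R$-module, then $\operatorname{End}_R(M)$ is right strongly exchange, where endomorphisms of the left module $M$ act on the right, so that the product $fg$ means first $f$, then $g$. Consequently, if $R$ is left continuous, then $R$ is right strongly exchange. -/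

import Mathlib

/-- The principal right ideal `aR`, as a submodule of the right module `R_R`. -/
def rightIdealOf {R : Type*} [Ring R] (a : R) : Submodule Rᵐᵒᵖ R :=
  Submodule.span Rᵐᵒᵖ {a}

/-- A pair of generators of a right coprime pair: elements `a`, `b` with `aR + bR = R`. -/
structure RightCoprimeGenerators (R : Type*) [Ring R] where
  a : R
  b : R
  coprime : rightIdealOf a ⊔ rightIdealOf b = ⊤

/-- `(a, b) ≤ (a', b')` when `aR ⊆ a'R` and `bR ⊆ b'R`. -/
instance RightCoprimeGenerators.instPreorder (R : Type*) [Ring R] :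
    Preorder (RightCoprimeGenerators R) where
  le x y := rightIdealOf x.a ≤ rightIdealOf y.a ∧ rightIdealOf x.b ≤ rightIdealOf y.b
  le_refl _ := ⟨le_rfl, le_rfl⟩
  le_trans _ _ _ h h' := ⟨h.1.trans h'.1, h.2.trans h'.2⟩

/-- The partially ordered set `RCP(R)` of right coprime pairs: pairs of generators `(a, b)`,
with `(a, b)` and `(a', b')` identified when `aR = a'R` and `bR = b'R`. -/
abbrev RCP (R : Type*) [Ring R] : Type _ :=
  Antisymmetrization (RightCoprimeGenerators R) (· ≤ ·)

/-- A compatible descending chain `{p_α | α < κ}` of right coprime pairs. -/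
def IsCompatibleDescendingChain {R : Type*} [Ring R] {κ : Ordinal}
    (p : Set.Iio κ → RCP R) : Prop :=
  Antitone p ∧
  ∃ (g : Set.Iio κ → RightCoprimeGenerators R) (r s : Set.Iio κ → Set.Iio κ → R),
    (∀ α, toAntisymmetrization (· ≤ ·) (g α) = p α) ∧
    (∀ α β, α < β → (g β).a = (g α).a * r α β ∧ (g β).b = (g α).b * s α β) ∧
    (∀ α γ β, α < γ → γ < β → r α β = r α γ * r γ β ∧ s α β = s α γ * s γ β)

universe w u v

/-- `R` is right strongly exchange if every compatible descending chain of right coprime pairs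
has a lower bound which is a minimal element of `RCP(R)`. The universe `w` is that of the
ordinals which index the chains. -/
def IsRightStronglyExchange (R : Type u) [Ring R] : Prop :=
  ∀ (κ : Ordinal.{w}) (p : Set.Iio κ → RCP R), IsCompatibleDescendingChain p →
    ∃ q : RCP R, (∀ α, q ≤ p α) ∧ IsMin q

/-- The submodule `N` is contained in the submodule `D`, and is essential in it. -/
def IsEssentialIn {R M : Type*} [Ring R] [AddCommGroup M] [Module R M]
    (N D : Submodule R M) : Prop :=
  N ≤ D ∧ ∀ L : Submodule R M, L ≤ D → N ⊓ L = ⊥ → L = ⊥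

/-- A continuous left module. Direct summands are the submodules which have a complement. -/
structure IsContinuousModule (R M : Type*) [Ring R] [AddCommGroup M] [Module R M] : Prop where
  /-- (C1) Every submodule is essential in a direct summand. -/
  c1 : ∀ N : Submodule R M, ∃ D : Submodule R M, IsComplemented D ∧ IsEssentialIn N D
  /-- (C2) A submodule isomorphic to a direct summand is a direct summand. -/
  c2 : ∀ N D : Submodule R M, IsComplemented D → Nonempty (N ≃ₗ[R] D) → IsComplemented N

/-- The endomorphism ring of a left module `M`, with endomorphisms written on the right of their
arguments: the product `f * g` means first `f`, then `g`. Mathlib's `Module.End R M` has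
the product `f ∘ g`, so this is its opposite ring. -/
abbrev LeftModuleEnd (R M : Type*) [Ring R] [AddCommGroup M] [Module R M] : Type _ :=
  (Module.End R M)ᵐᵒᵖ

/-! In the endomorphism ring, `x ∈ aT` means that `x` factors as `a` followed by some `t`, so
shrinking right ideals have growing kernels, and a coprime pair has kernels meeting in zero. Along a
chain the unions of the kernels stay disjoint, so continuity separates them by a decomposition `M =
E ⊕ D`. The projection `e` onto `D` along `E` kills every `ker a_α`, and `1 - e` kills every `ker
b_α`. By (C2) this inclusion of kernels already forces the factorizations
(`exists_comp_eq_projection`), so `(e, 1 - e)` lies below the chain; it is minimal because `e` is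
idempotent. -/

section ContinuousModule

variable {R M : Type*} [Ring R] [AddCommGroup M] [Module R M]

/-- In a continuous module a direct summand has a complement above any given submodule which it
meets trivially. -/
theorem IsContinuousModule.exists_le_isCompl (hM : IsContinuousModule R M)
    {A L : Submodule R M} (hA : IsComplemented A) (hAL : Disjoint A L) :
    ∃ D : Submodule R M, L ≤ D ∧ IsCompl A D := by
  obtain ⟨D, hD, hLD, hess⟩ := hM.c1 L
  have hAD : Disjoint A D := disjoint_iff.2 <| hess _ inf_le_right <| by
    rw [← inf_assoc, inf_comm L A, hAL.eq_bot, bot_inf_eq]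
  obtain ⟨B, hAB⟩ := hA
  let p : M →ₗ[R] M := B.projection A hAB.symm
  have hp : ∀ x, x - p x ∈ A := B.sub_projection_mem hAB.symm
  have hpB : ∀ x, p x ∈ B := B.projection_apply_mem hAB.symm
  have hpA : ∀ x ∈ A, p x = 0 := fun x hx =>
    (Submodule.projection_apply_eq_zero_iff hAB.symm).2 hx
  have hpB' : ∀ x ∈ B, p x = x := fun x hx =>
    Submodule.projection_apply_of_mem_left hAB.symm hx
  have hpD : ∀ x ∈ D, p x = 0 → x = 0 := fun x hx h =>
    Submodule.disjoint_def.1 hAD x (by simpa [h] using hp x) hx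
  have hinj : Function.Injective (p.domRestrict D) := by
    rw [← LinearMap.ker_eq_bot, LinearMap.ker_eq_bot']
    intro x hx
    exact Subtype.ext (hpD x x.2 hx)
  obtain ⟨N, hN⟩ := hM.c2 (LinearMap.range (p.domRestrict D)) D hD
    ⟨(LinearEquiv.ofInjective _ hinj).symm⟩
  -- Since `p(D) ≤ B`, modularity gives `B = p(D) ⊕ (N ⊓ B)`. Thus `p`, whose kernel is `A`, maps `D
  -- ⊔ N ⊓ B` isomorphically onto `B`.
  refine ⟨D ⊔ N ⊓ B, hLD.trans le_sup_left, ?_, ?_⟩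
  · rw [Submodule.disjoint_def]
    intro y hyA hy
    obtain ⟨d, hd, x, hx, rfl⟩ := Submodule.mem_sup.1 hy
    have h0 : p d + x = 0 := by
      rw [← hpB' x hx.2, ← map_add, hpA _ hyA]
    have hpd : p d = 0 := Submodule.disjoint_def.1 hN.disjoint _ ⟨⟨d, hd⟩, rfl⟩ <| by
      rw [eq_neg_of_add_eq_zero_left h0]
      exact N.neg_mem hx.1
    rw [hpd, zero_add] at h0
    rw [h0, hpD d hd hpd, add_zero]
  · rw [codisjoint_iff, eq_top_iff]
    intro m _
    have hm : p m ∈ LinearMap.range (p.domRestrict D) ⊔ N := hN.sup_eq_top ▸ Submodule.mem_top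
    obtain ⟨_, ⟨d, rfl⟩, n, hn, hdn⟩ := Submodule.mem_sup.1 hm
    rw [LinearMap.domRestrict_apply] at hdn
    have hnB : n ∈ B := by
      rw [eq_sub_of_add_eq' hdn]
      exact B.sub_mem (hpB m) (hpB d)
    have key : m = ((m - p m) - ((d : M) - p d)) + ((d : M) + n) := by
      rw [← hdn]
      abel
    rw [key]
    exact Submodule.add_mem_sup (A.sub_mem (hp m) (hp d))
      (Submodule.add_mem_sup d.2 ⟨hn, hnB⟩)

/-- Disjoint submodules of a continuous module lie in complementary direct summands. -/
theorem IsContinuousModule.exists_isCompl_of_disjoint (hM : IsContinuousModule R M)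
    {K L : Submodule R M} (hKL : Disjoint K L) :
    ∃ E D : Submodule R M, K ≤ E ∧ L ≤ D ∧ IsCompl E D := by
  obtain ⟨E, hE, hKE, hess⟩ := hM.c1 K
  have hEL : Disjoint E L := disjoint_iff.2 <| hess _ inf_le_left <| by
    rw [inf_comm E L, ← inf_assoc, hKL.eq_bot, bot_inf_eq]
  obtain ⟨D, hLD, hED⟩ := hM.exists_le_isCompl hE hEL
  exact ⟨E, D, hKE, hLD, hED⟩

/-- A projection of a continuous module factors through every endomorphism whose kernel lies in
the kernel of the projection. -/
theorem IsContinuousModule.exists_comp_eq_projection (hM : IsContinuousModule R M)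
    {D E : Submodule R M} (h : IsCompl D E) (a : Module.End R M) (ha : LinearMap.ker a ≤ E) :
    ∃ t : Module.End R M, t * a = D.projection E h := by
  have hinj : Function.Injective (a.domRestrict D) := by
    rw [← LinearMap.ker_eq_bot, LinearMap.ker_eq_bot']
    intro x hx
    exact Subtype.ext (Submodule.disjoint_def.1 h.disjoint x x.2 (ha hx))
  let φ := LinearEquiv.ofInjective _ hinj
  have hA : IsComplemented (LinearMap.range (a.domRestrict D)) := hM.c2 _ D ⟨E, h⟩ ⟨φ.symm⟩
  have hdisj : Disjoint (LinearMap.range (a.domRestrict D)) (E.map a) := by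
    rw [Submodule.disjoint_def]
    rintro _ ⟨d, rfl⟩ ⟨y, hy, hyd⟩
    rw [LinearMap.domRestrict_apply] at hyd ⊢
    have hmem : (d : M) - y ∈ E := ha (by rw [LinearMap.mem_ker, map_sub, hyd, sub_self])
    have hd : (d : M) ∈ E := by simpa using E.add_mem hmem hy
    rw [Submodule.disjoint_def.1 h.disjoint d d.2 hd, map_zero]
  obtain ⟨C, hEC, hC⟩ := hM.exists_le_isCompl hA hdisj
  -- `t` inverts `a` on `a(D)` and vanishes on `C`, which contains `a(E)`.
  refine ⟨D.subtype ∘ₗ φ.symm.toLinearMap ∘ₗ Submodule.projectionOnto _ C hC, ?_⟩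
  ext x
  obtain ⟨d, y, rfl, -⟩ := Submodule.existsUnique_add_of_isCompl h x
  have hy : Submodule.projectionOnto _ C hC (a y) = 0 :=
    (Submodule.projectionOnto_apply_eq_zero_iff hC).2 (hEC ⟨y, y.2, rfl⟩)
  have hd : Submodule.projectionOnto _ C hC (a d) = φ d :=
    Submodule.projectionOnto_apply_left hC (φ d)
  simp [hy, hd]

end ContinuousModule

section RightCoprimePairs

variable {T : Type*} [Ring T]

theorem mem_rightIdealOf {a x : T} : x ∈ rightIdealOf a ↔ ∃ t, x = a * t := by
  rw [rightIdealOf, Submodule.mem_span_singleton]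
  constructor
  · rintro ⟨t, rfl⟩
    exact ⟨t.unop, rfl⟩
  · rintro ⟨t, rfl⟩
    exact ⟨MulOpposite.op t, rfl⟩

theorem rightIdealOf_le_iff {a b : T} : rightIdealOf a ≤ rightIdealOf b ↔ a ∈ rightIdealOf b :=
  Submodule.span_singleton_le_iff_mem a (rightIdealOf b)

/-- The right coprime pair `(e, 1 - e)`. -/
def RightCoprimeGenerators.ofElement (e : T) : RightCoprimeGenerators T where
  a := e
  b := 1 - e
  coprime := by
    rw [eq_top_iff]
    intro x _
    have hx : x = e * x + (1 - e) * x := by noncomm_ring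
    rw [hx]
    exact Submodule.add_mem_sup (mem_rightIdealOf.2 ⟨x, rfl⟩) (mem_rightIdealOf.2 ⟨x, rfl⟩)

theorem IsIdempotentElem.disjoint_rightIdealOf {e : T} (he : IsIdempotentElem e) :
    Disjoint (rightIdealOf e) (rightIdealOf (1 - e)) := by
  rw [Submodule.disjoint_def]
  intro x hx hx'
  obtain ⟨t, rfl⟩ := mem_rightIdealOf.1 hx
  obtain ⟨s, hs⟩ := mem_rightIdealOf.1 hx'
  calc e * t = e * (e * t) := by rw [← mul_assoc, he.eq]
    _ = (e * (1 - e)) * s := by rw [hs, mul_assoc]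
    _ = 0 := by rw [he.mul_one_sub_self, zero_mul]

/-- A right coprime pair whose right ideals intersect trivially is minimal. -/
theorem RightCoprimeGenerators.isMin_of_disjoint (g : RightCoprimeGenerators T)
    (hg : Disjoint (rightIdealOf g.a) (rightIdealOf g.b)) : IsMin g := by
  rintro f ⟨ha, hb⟩
  have h₁ : rightIdealOf f.a ⊔ rightIdealOf g.b = ⊤ :=
    eq_top_iff.2 (f.coprime.ge.trans (sup_le_sup_left hb _))
  have h₂ : rightIdealOf f.b ⊔ rightIdealOf g.a = ⊤ :=
    eq_top_iff.2 (f.coprime.ge.trans (sup_le (le_sup_of_le_right ha) le_sup_left))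
  exact ⟨(eq_of_le_of_inf_le_of_sup_le ha (hg.eq_bot.trans_le bot_le) (le_top.trans_eq h₁.symm)).ge,
    (eq_of_le_of_inf_le_of_sup_le hb (hg.symm.eq_bot.trans_le bot_le)
      (le_top.trans_eq h₂.symm)).ge⟩

/-- A ring is right strongly exchange if below every descending chain of right coprime pairs there
is a pair given by an idempotent and its complement. -/
theorem isRightStronglyExchange_of_exists_idempotent
    (h : ∀ (κ : Ordinal.{w}) (g : Set.Iio κ → RightCoprimeGenerators T), Antitone g →
      ∃ e : T, IsIdempotentElem e ∧
        ∀ α, e ∈ rightIdealOf (g α).a ∧ 1 - e ∈ rightIdealOf (g α).b) :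
    IsRightStronglyExchange.{w} T := by
  rintro κ p ⟨hp, g, -, -, hg, -, -⟩
  have hanti : Antitone g := fun α β hαβ => by
    rw [← toAntisymmetrization_le_toAntisymmetrization_iff, hg, hg]
    exact hp hαβ
  obtain ⟨e, he, hle⟩ := h κ g hanti
  refine ⟨toAntisymmetrization (· ≤ ·) (RightCoprimeGenerators.ofElement e), fun α => ?_, ?_⟩
  · rw [← hg α, toAntisymmetrization_le_toAntisymmetrization_iff]
    exact ⟨rightIdealOf_le_iff.2 (hle α).1, rightIdealOf_le_iff.2 (hle α).2⟩
  · have hmin : IsMin (RightCoprimeGenerators.ofElement e) :=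
      (RightCoprimeGenerators.ofElement e).isMin_of_disjoint he.disjoint_rightIdealOf
    intro q
    induction q using Antisymmetrization.ind with
    | _ f =>
      intro hf
      rw [toAntisymmetrization_le_toAntisymmetrization_iff] at hf ⊢
      exact hmin hf

end RightCoprimePairs

section EndomorphismRing

variable {R M T : Type*} [Ring R] [AddCommGroup M] [Module R M] [Ring T]

/-- Under an identification of `T` with the endomorphism ring of a left module, membership in a
principal right ideal is a factorization of endomorphisms. -/
theorem mem_rightIdealOf_iff_exists_comp (φ : T ≃+* LeftModuleEnd R M) {a x : T} :
    x ∈ rightIdealOf a ↔ ∃ t : Module.End R M, t * (φ a).unop = (φ x).unop := by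
  rw [mem_rightIdealOf]
  constructor
  · rintro ⟨t, rfl⟩
    exact ⟨(φ t).unop, by simp⟩
  · rintro ⟨t, ht⟩
    refine ⟨φ.symm (MulOpposite.op t), φ.injective (MulOpposite.unop_injective ?_)⟩
    simp [ht]

theorem ker_le_ker_of_rightIdealOf_le (φ : T ≃+* LeftModuleEnd R M) {a b : T}
    (h : rightIdealOf a ≤ rightIdealOf b) :
    LinearMap.ker (φ b).unop ≤ LinearMap.ker (φ a).unop := by
  obtain ⟨t, ht⟩ := (mem_rightIdealOf_iff_exists_comp φ).1 (rightIdealOf_le_iff.1 h)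
  intro x hx
  rw [LinearMap.mem_ker] at hx ⊢
  rw [← ht, Module.End.mul_apply, hx, map_zero]

/-- Coprimality writes the identity as `t * a + s * b`, so a vector killed by both `a` and `b` is
zero. -/
theorem RightCoprimeGenerators.disjoint_ker (φ : T ≃+* LeftModuleEnd R M)
    (g : RightCoprimeGenerators T) :
    Disjoint (LinearMap.ker (φ g.a).unop) (LinearMap.ker (φ g.b).unop) := by
  have h1 : (1 : T) ∈ rightIdealOf g.a ⊔ rightIdealOf g.b := g.coprime ▸ Submodule.mem_top
  obtain ⟨u, hu, v, hv, huv⟩ := Submodule.mem_sup.1 h1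
  obtain ⟨t, ht⟩ := (mem_rightIdealOf_iff_exists_comp φ).1 hu
  obtain ⟨s, hs⟩ := (mem_rightIdealOf_iff_exists_comp φ).1 hv
  have key : t * (φ g.a).unop + s * (φ g.b).unop = 1 := by
    rw [ht, hs, ← MulOpposite.unop_add, ← map_add, huv, map_one, MulOpposite.unop_one]
  rw [Submodule.disjoint_def]
  intro x hx hy
  rw [LinearMap.mem_ker] at hx hy
  simpa [hx, hy] using (LinearMap.congr_fun key x).symm

/-- The endomorphism ring of a continuous left module is right strongly exchange. -/
theorem IsContinuousModule.isRightStronglyExchange (hM : IsContinuousModule R M)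
    (φ : T ≃+* LeftModuleEnd R M) : IsRightStronglyExchange.{w} T := by
  refine isRightStronglyExchange_of_exists_idempotent fun κ g hg => ?_
  have hK : Monotone fun α => LinearMap.ker (φ (g α).a).unop := fun α β h =>
    ker_le_ker_of_rightIdealOf_le φ (hg h).1
  have hL : Monotone fun α => LinearMap.ker (φ (g α).b).unop := fun α β h =>
    ker_le_ker_of_rightIdealOf_le φ (hg h).2
  have hKL : Disjoint (⨆ α, LinearMap.ker (φ (g α).a).unop)
      (⨆ α, LinearMap.ker (φ (g α).b).unop) := by
    -- Both families of kernels increase, so any two members are compared at the larger index, where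
    -- coprimality applies.
    rw [hK.directed_le.disjoint_iSup_left]
    intro α
    rw [hL.directed_le.disjoint_iSup_right]
    intro β
    exact ((g (max α β)).disjoint_ker φ).mono (hK (le_max_left α β)) (hL (le_max_right α β))
  obtain ⟨E, D, hE, hD, hED⟩ := hM.exists_isCompl_of_disjoint hKL
  let e : T := φ.symm (MulOpposite.op (D.projection E hED.symm))
  have he : (φ e).unop = D.projection E hED.symm := by simp [e]
  have he' : (φ (1 - e)).unop = E.projection D hED := by
    rw [map_sub, map_one, MulOpposite.unop_sub, he, MulOpposite.unop_one]
    exact (Submodule.projection_eq_id_sub_projection hED.symm).symm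
  refine ⟨e, φ.injective (MulOpposite.unop_injective ?_), fun α => ⟨?_, ?_⟩⟩
  · rw [map_mul, MulOpposite.unop_mul, he]
    exact Submodule.isIdempotentElem_projection hED.symm
  · rw [mem_rightIdealOf_iff_exists_comp φ, he]
    exact hM.exists_comp_eq_projection hED.symm _ ((le_iSup _ α).trans hE)
  · rw [mem_rightIdealOf_iff_exists_comp φ, he']
    exact hM.exists_comp_eq_projection hED _ ((le_iSup _ α).trans hD)

end EndomorphismRing

theorem theoremt (R : Type u) [Ring R] :
    (∀ (M : Type v) [AddCommGroup M] [Module R M],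
      IsContinuousModule R M → IsRightStronglyExchange.{w} (LeftModuleEnd R M)) ∧
    (IsContinuousModule R R → IsRightStronglyExchange.{w} R) :=
  ⟨fun _ _ _ hM => hM.isRightStronglyExchange (RingEquiv.refl _),
    fun hR => hR.isRightStronglyExchange
      -- `R` is its own left module endomorphism ring, acting by right multiplications.
      ((RingEquiv.opOp R).trans (RingEquiv.op (RingEquiv.moduleEndSelf R)))⟩
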